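/- Let $\Lambda$ be a Latin square of order $n$, with set of cells $\Omega$ ($|\Omega|=n^2$), and let $\Gamma$ be its Latin-square graph: the vertex set is $\Omega$, and two distinct cells are joined if they lie in the same row, lie in the same column, or contain the same letter. It is regular with valency $k=3(n-1)$. Rows, columns and letters are regarded as $n$-element subsets of $\Omega$, a letter being identified with the set of cells in which it occurs. A partition $\Delta=\{\Delta_1,\dots,\Delta_r\}$ of $\Omega$ into non-empty parts is *equitable* if there is a matrix $M=(m_{ij})$ (the *quotient matrix*) such that every vertex in $\Delta_i$ has exactly $m_{ij}$ neighbours in $\Delta_j$, for all $i,j$. It is *$\mu$-equitable* if it is equitable and every eigenvalue of $M$ other than the principal eigenvalue $k$ is equal to $\mu$. A Latin square $\Lambda$ is an *$s$-fold inflation* of a Latin square $\Lambda_0$ of order $t$ if the rows, the columns and the letters of $\Lambda$ can each be divided into $t$ classes of size $s$, indexed respectively by the rows, columns and letters of $\Lambda_0$, such that every cell of $\Lambda$ whose row is in class $a$ and whose column is in class $b$ contains a letter in the class indexed by the entry of $\Lambda_0$ in row $a$ and column $b$. (So $\Lambda$ arises from $\Lambda_0$ by replacing each occurrence of a letter $c$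 by an $s\times s$ Latin square on an alphabet $\mathcal A_c$, the alphabets being disjoint.) The *inflation* of a set $K$ of cells of $\Lambda_0$ is the set of cells of $\Lambda$ whose row class $a$ and column class $b$ satisfy $(a,b)\in K$. The cyclic Latin square of order $t$ has rows, columns and letters indexed by $\{0,1,\dots,t-1\}$ and has letter $i+j \bmod t$ in cell $(i,j)$. A *corner set* is the set of cells $(i,j)$ of this square with $i+j<t-1$ (ordinary integer addition), or its image under any relabelling of the rows, columns and letters, as a set of cells of the relabelled square. **Theorem.** A partition $\Delta$ of $\Omega$ is $(n-3)$-equitable for $\Gamma$ if and only if each part of $\Delta$ is a union of pairwise disjoint sets, each of which is a row, a column or a letter of $\Lambda$, or the inflation of a corner set of some Latin square $\Lambda_0$ of which $\Lambda$ is an $s$-fold inflation, for some $s$. -/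

import Mathlib

/-- A Latin square of order `n`: an `n × n` array, with rows, columns and letters indexed by
`Fin n`, in which each letter occurs exactly once in each row and exactly once in each column. -/
structure LatinSquare (n : ℕ) where
  /-- the letter in row `i` and column `j` -/
  letter : Fin n → Fin n → Fin n
  row_bijective : ∀ i, Function.Bijective (letter i)
  col_bijective : ∀ j, Function.Bijective (fun i => letter i j)

/-- The cells of an `n × n` array, as pairs (row, column). -/
abbrev Cell (n : ℕ) : Type := Fin n × Fin n

namespace LatinSquare

/-- The Latin-square graph: distinct cells are joined when they lie in the same row, in the same
column, or carry the same letter. -/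
def graph {n : ℕ} (Λ : LatinSquare n) : SimpleGraph (Cell n) where
  Adj p q := p ≠ q ∧ (p.1 = q.1 ∨ p.2 = q.2 ∨ Λ.letter p.1 p.2 = Λ.letter q.1 q.2)
  symm := ⟨fun _ _ h => ⟨h.1.symm, h.2.imp Eq.symm (Or.imp Eq.symm Eq.symm)⟩⟩
  loopless := ⟨fun _ h => h.1 rfl⟩

instance {n : ℕ} (Λ : LatinSquare n) : DecidableRel Λ.graph.Adj := fun p q =>
  inferInstanceAs
    (Decidable (p ≠ q ∧ (p.1 = q.1 ∨ p.2 = q.2 ∨ Λ.letter p.1 p.2 = Λ.letter q.1 q.2)))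

/-- The set of cells `S` is one of the rows. -/
def IsRow {n : ℕ} (S : Set (Cell n)) : Prop := ∃ i : Fin n, S = {p | p.1 = i}

/-- The set of cells `S` is one of the columns. -/
def IsColumn {n : ℕ} (S : Set (Cell n)) : Prop := ∃ j : Fin n, S = {p | p.2 = j}

/-- The set of cells `S` is one of the letters of `Λ`, regarded as the set of the cells in which
the letter occurs. -/
def IsLetter {n : ℕ} (Λ : LatinSquare n) (S : Set (Cell n)) : Prop :=
  ∃ ℓ : Fin n, S = {p | Λ.letter p.1 p.2 = ℓ}

/-- The (back-)cyclic Latin square of order `t`: the letter in row `i` and column `j` is `i + j`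
modulo `t`. -/
def cyclic (t : ℕ) : LatinSquare t where
  letter i j := i + j
  row_bijective i := by
    have : NeZero t := ⟨by rintro rfl; exact i.elim0⟩
    exact (Equiv.addLeft i).bijective
  col_bijective j := by
    have : NeZero t := ⟨by rintro rfl; exact j.elim0⟩
    exact (Equiv.addRight j).bijective

/-- `K` is a corner set of the Latin square `Λ₀` of order `t`: for some relabelling `α`, `β`, `γ`
of rows, columns and letters that carries the cyclic square of order `t` to `Λ₀`, the set `K` is
the image of the set of cells `(i, j)`, `0 ≤ i, j ≤ t - 1`, with `i + j < t - 1` (addition of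
integers). -/
def IsCornerSet {t : ℕ} (Λ₀ : LatinSquare t) (K : Set (Cell t)) : Prop :=
  ∃ α β γ : Equiv.Perm (Fin t),
    (∀ i j, Λ₀.letter (α i) (β j) = γ ((cyclic t).letter i j)) ∧
    K = {q | ∃ i j : Fin t, (i : ℕ) + (j : ℕ) + 1 < t ∧ q = (α i, β j)}

/-- The data exhibiting `Λ` as an `s`-fold inflation of `Λ₀`: rows, columns and letters of `Λ` are
grouped into fat rows, fat columns and fat letters, each consisting of `s` of them and indexed by
the rows, columns and letters of `Λ₀`, so that the `s × s` block of cells in fat row `a` and fat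
column `b` is filled from the alphabet of `s` letters that belongs to the letter of `Λ₀` in row `a`
and column `b`. (The block is then a Latin square on this alphabet.) -/
structure Inflation {n t : ℕ} (Λ : LatinSquare n) (Λ₀ : LatinSquare t) (s : ℕ) where
  /-- the fat row containing a given row -/
  fatRow : Fin n → Fin t
  /-- the fat column containing a given column -/
  fatColumn : Fin n → Fin t
  /-- the fat letter containing a given letter -/
  fatLetter : Fin n → Fin t
  card_fatRow : ∀ a, (Finset.univ.filter fun i => fatRow i = a).card = s
  card_fatColumn : ∀ b, (Finset.univ.filter fun j => fatColumn j = b).card = s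
  card_fatLetter : ∀ c, (Finset.univ.filter fun ℓ => fatLetter ℓ = c).card = s
  letter_mem : ∀ i j, fatLetter (Λ.letter i j) = Λ₀.letter (fatRow i) (fatColumn j)

/-- The inflation of a set `K` of cells of `Λ₀`: the union of the blocks that replace the cells
in `K`. -/
def Inflation.inflate {n t s : ℕ} {Λ : LatinSquare n} {Λ₀ : LatinSquare t}
    (I : Inflation Λ Λ₀ s) (K : Set (Cell t)) : Set (Cell n) :=
  {p | (I.fatRow p.1, I.fatColumn p.2) ∈ K}

/-- `S` is, in the Latin square `Λ`, an inflation of a corner set. -/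
def IsInflatedCornerSet {n : ℕ} (Λ : LatinSquare n) (S : Set (Cell n)) : Prop :=
  ∃ (t s : ℕ) (Λ₀ : LatinSquare t) (I : Inflation Λ Λ₀ s) (K : Set (Cell t)),
    Λ₀.IsCornerSet K ∧ S = I.inflate K

end LatinSquare

/-- `M` is the quotient matrix of the partition `P` of the vertex set of `G`: every vertex of the
part `D` has exactly `M D E` neighbours in the part `E`. -/
def IsQuotientMatrix {V : Type*} [Fintype V] [DecidableEq V] (G : SimpleGraph V)
    [DecidableRel G.Adj] (P : Finpartition (Finset.univ : Finset V))
    (M : Matrix P.parts P.parts ℕ) : Prop :=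
  ∀ D E : P.parts, ∀ v ∈ D.1, (G.neighborFinset v ∩ E.1).card = M D E

/-- The partition `P` of the vertex set of the regular graph `G` is `μ`-equitable: it is equitable,
that is, it has a quotient matrix `M`, and all (complex) eigenvalues of `M` other than the principal
one, the valency `k` of `G`, are equal to `μ`. -/
def IsMuEquitable {V : Type*} [Fintype V] [DecidableEq V] (G : SimpleGraph V)
    [DecidableRel G.Adj] (P : Finpartition (Finset.univ : Finset V)) (μ : ℝ) : Prop :=
  ∃ (k : ℕ) (M : Matrix P.parts P.parts ℕ),
    G.IsRegularOfDegree k ∧ IsQuotientMatrix G P M ∧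
    ∀ θ : ℂ, Module.End.HasEigenvalue (Matrix.toLin' (M.map (fun m => (m : ℂ)))) θ →
      θ ≠ (k : ℂ) → θ = (μ : ℂ)

/-!
Let `U` be the space of functions on the cells of the form `f (row) + g (column) + h (letter)`. If
`A` is the adjacency matrix of the Latin-square graph, then `A + 3` is the sum of the three
relations of lying in the same row, in the same column and of carrying the same letter. So `A + 3`
has its image in `U`, and this gives the equivalence of the spectral condition with the condition
that the indicator of every part lies in `U`. In one direction, the quotient matrix `M` does not
have the eigenvalue `-3`, so `M + 3` is invertible and each indicator is in the image of `A + 3`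
(`LatinSquare.cellInd_mem_lineSpace_of_isMuEquitable`). In the other, the numbers of neighbours are
given by the line counts, and the quotient matrix turns out to be `n - 3` plus a matrix with equal
rows (`LatinSquare.isMuEquitable_of_cellInd_mem_lineSpace`).

It remains to find the sets `S` whose indicator lies in `U`. The indicator of a disjoint union is
the sum of the indicators, and those of lines and of inflated corner sets are in `U`. Conversely,
lines contained in `S` can be split off, so let `S` contain no line. Then the numbers `r i`, `c j`,
`l ℓ` of cells of `S` in the rows, columns and letters are less than `n`, and they satisfy
`r i + c j + l (letter i j) = m + n [(i, j) ∈ S]` for a constant `m`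
(`LatinSquare.exists_count_relation`).
Reading this modulo `n` along a row or a column shows that the distributions of `r`, `c`, `l` over
the residues modulo `n` are mirror images of each other, and that each difference of two values is
a period of them. Hence, if the periods are the multiples of `s`, each of `r`, `c`, `l` is
uniformly distributed over one residue class modulo `s`. Division by `s` then divides rows, columns
and letters into `t = n / s` classes of size `s`, on which `Λ` induces the cyclic square of order
`t`. As no row is contained in `S`, the constant `m` is the one for which `S` is the inflation of a
corner set (`LatinSquare.isInflatedCornerSet_of_count_lt`).
-/

namespace LatinSquare

variable {n : ℕ}

/-! ### Functions that are sums of a row, a column and a letter function -/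

/-- The space of complex functions on the cells of `Λ` of the form
`(i, j) ↦ f i + g j + h (letter i j)`; it is spanned by the indicators of the rows, columns and
letters. -/
def lineSpace (Λ : LatinSquare n) : Submodule ℂ (Cell n → ℂ) where
  carrier := {φ | ∃ f g h : Fin n → ℂ, ∀ i j, φ (i, j) = f i + g j + h (Λ.letter i j)}
  add_mem' := by
    rintro _ _ ⟨f, g, h, e⟩ ⟨f', g', h', e'⟩
    refine ⟨f + f', g + g', h + h', fun i j => ?_⟩
    simp only [Pi.add_apply, e, e']
    ring
  zero_mem' := ⟨0, 0, 0, fun i j => by simp⟩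
  smul_mem' := by
    rintro a _ ⟨f, g, h, e⟩
    refine ⟨a • f, a • g, a • h, fun i j => ?_⟩
    simp only [Pi.smul_apply, smul_eq_mul, e]
    ring

theorem mem_lineSpace {Λ : LatinSquare n} {φ : Cell n → ℂ} :
    φ ∈ Λ.lineSpace ↔
      ∃ f g h : Fin n → ℂ, ∀ i j, φ (i, j) = f i + g j + h (Λ.letter i j) := Iff.rfl

/-- The number of cells of `S` in row `i`. -/
def rowCount (S : Finset (Cell n)) (i : Fin n) : ℕ := (S.filter fun p => p.1 = i).card

/-- The number of cells of `S` in column `j`. -/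
def colCount (S : Finset (Cell n)) (j : Fin n) : ℕ := (S.filter fun p => p.2 = j).card

/-- The number of cells of `S` carrying the letter `ℓ`. -/
def letterCount (Λ : LatinSquare n) (S : Finset (Cell n)) (ℓ : Fin n) : ℕ :=
  (S.filter fun p => Λ.letter p.1 p.2 = ℓ).card

/-- The indicator function of a set of cells. -/
noncomputable def cellInd (S : Set (Cell n)) : Cell n → ℂ := S.indicator 1

theorem cellInd_apply (S : Finset (Cell n)) (p : Cell n) :
    cellInd (S : Set (Cell n)) p = if p ∈ S then 1 else 0 := by
  classical
  simp [cellInd, Set.indicator_apply]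

theorem sum_letter_eq_row (Λ : LatinSquare n) (i ℓ : Fin n) :
    ∑ j, (if Λ.letter i j = ℓ then (1 : ℂ) else 0) = 1 := by
  obtain ⟨j₀, h₀⟩ := (Λ.row_bijective i).2 ℓ
  rw [Finset.sum_eq_single j₀]
  · exact if_pos h₀
  · intro j _ hj
    exact if_neg fun h => hj ((Λ.row_bijective i).1 (h.trans h₀.symm))
  · simp

theorem sum_letter_eq_col (Λ : LatinSquare n) (j ℓ : Fin n) :
    ∑ i, (if Λ.letter i j = ℓ then (1 : ℂ) else 0) = 1 := by
  obtain ⟨i₀, h₀⟩ := (Λ.col_bijective j).2 ℓ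
  rw [Finset.sum_eq_single i₀]
  · exact if_pos h₀
  · intro i _ hi
    exact if_neg fun h => hi ((Λ.col_bijective j).1 (h.trans h₀.symm))
  · simp

theorem rowCount_eq_sum (S : Finset (Cell n)) (i : Fin n) :
    (rowCount S i : ℂ) = ∑ j, cellInd (S : Set (Cell n)) (i, j) := by
  have : (rowCount S i : ℂ) =
      ∑ p : Cell n, if p.1 = i then cellInd (S : Set (Cell n)) p else 0 := by
    simp only [cellInd_apply]
    rw [← Finset.sum_filter, Finset.sum_ite_mem, rowCount, Finset.sum_const, nsmul_one]
    congr 2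
    ext p; simp [and_comm]
  rw [this, Fintype.sum_prod_type, Finset.sum_eq_single i]
  · simp
  · intro b _ hb; simp [hb]
  · simp

theorem colCount_eq_sum (S : Finset (Cell n)) (j : Fin n) :
    (colCount S j : ℂ) = ∑ i, cellInd (S : Set (Cell n)) (i, j) := by
  have : (colCount S j : ℂ) =
      ∑ p : Cell n, if p.2 = j then cellInd (S : Set (Cell n)) p else 0 := by
    simp only [cellInd_apply]
    rw [← Finset.sum_filter, Finset.sum_ite_mem, colCount, Finset.sum_const, nsmul_one]
    congr 2
    ext p; simp [and_comm]
  rw [this, Fintype.sum_prod_type]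
  simp

theorem letterCount_eq_sum (Λ : LatinSquare n) (S : Finset (Cell n)) (ℓ : Fin n) :
    (Λ.letterCount S ℓ : ℂ) =
      ∑ i, ∑ j, if Λ.letter i j = ℓ then cellInd (S : Set (Cell n)) (i, j) else 0 := by
  have : (Λ.letterCount S ℓ : ℂ) =
      ∑ p : Cell n, if Λ.letter p.1 p.2 = ℓ then cellInd (S : Set (Cell n)) p else 0 := by
    simp only [cellInd_apply]
    rw [← Finset.sum_filter, Finset.sum_ite_mem, letterCount, Finset.sum_const, nsmul_one]
    congr 2
    ext p; simp [and_comm]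
  rw [this, Fintype.sum_prod_type]

theorem rowCount_univ (i : Fin n) : rowCount Finset.univ i = n := by
  have h : (rowCount Finset.univ i : ℂ) = n := by
    rw [rowCount_eq_sum]
    simp [cellInd]
  exact_mod_cast h

theorem colCount_univ (j : Fin n) : colCount Finset.univ j = n := by
  have h : (colCount Finset.univ j : ℂ) = n := by
    rw [colCount_eq_sum]
    simp [cellInd]
  exact_mod_cast h

theorem letterCount_univ (Λ : LatinSquare n) (ℓ : Fin n) :
    Λ.letterCount Finset.univ ℓ = n := by
  have h : (Λ.letterCount Finset.univ ℓ : ℂ) = n := by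
    rw [letterCount_eq_sum, Finset.sum_comm]
    simp only [cellInd, Finset.coe_univ, Set.indicator_univ, Pi.one_apply, sum_letter_eq_col]
    simp
  exact_mod_cast h

/-- If the indicator of `S` is `f + g + h`, then summing along lines expresses `f`, `g`, `h` by the
line counts of `S`, up to constants; eliminating them leaves a relation between integers. -/
theorem exists_count_relation {Λ : LatinSquare n} {S : Finset (Cell n)}
    (hS : cellInd (S : Set (Cell n)) ∈ Λ.lineSpace) :
    ∃ m : ℤ, ∀ i j, (rowCount S i : ℤ) + colCount S j + Λ.letterCount S (Λ.letter i j) =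
      m + if (i, j) ∈ S then (n : ℤ) else 0 := by
  obtain ⟨f, g, h, e⟩ := mem_lineSpace.1 hS
  have hr : ∀ i, (rowCount S i : ℂ) = n * f i + ∑ j, g j + ∑ ℓ, h ℓ := by
    intro i
    rw [rowCount_eq_sum]
    simp only [e, Finset.sum_add_distrib]
    rw [(Λ.row_bijective i).sum_comp h]
    simp
  have hc : ∀ j, (colCount S j : ℂ) = n * g j + ∑ i, f i + ∑ ℓ, h ℓ := by
    intro j
    rw [colCount_eq_sum]
    simp only [e, Finset.sum_add_distrib]
    rw [(Λ.col_bijective j).sum_comp h]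
    simp
    ring
  have hl : ∀ ℓ, (Λ.letterCount S ℓ : ℂ) = n * h ℓ + ∑ i, f i + ∑ j, g j := by
    intro ℓ
    rw [letterCount_eq_sum]
    have h1 : ∀ i j, (if Λ.letter i j = ℓ then cellInd (S : Set (Cell n)) (i, j) else 0) =
        (f i + h ℓ) * (if Λ.letter i j = ℓ then 1 else 0) +
          g j * (if Λ.letter i j = ℓ then 1 else 0) := by
      intro i j
      split_ifs with hij
      · rw [e, hij]; ring
      · simp
    simp only [h1, Finset.sum_add_distrib]
    rw [Finset.sum_comm (f := fun i j => g j * (if Λ.letter i j = ℓ then (1 : ℂ) else 0))]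
    simp only [← Finset.mul_sum, sum_letter_eq_col, sum_letter_eq_row, mul_one,
      Finset.sum_add_distrib]
    simp
    ring
  have key : ∀ i j, (rowCount S i : ℂ) + colCount S j + Λ.letterCount S (Λ.letter i j) =
      2 * (∑ i, f i + ∑ j, g j + ∑ ℓ, h ℓ) + if (i, j) ∈ S then (n : ℂ) else 0 := by
    intro i j
    have h2 : (if (i, j) ∈ S then (n : ℂ) else 0) = n * cellInd (S : Set (Cell n)) (i, j) := by
      rw [cellInd_apply]; simp
    rw [h2, e, hr, hc, hl]
    ring
  rcases Nat.eq_zero_or_pos n with rfl | hn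
  · exact ⟨0, fun i => i.elim0⟩
  · let o : Fin n := ⟨0, hn⟩
    refine ⟨(rowCount S o : ℤ) + colCount S o + Λ.letterCount S (Λ.letter o o) -
      if (o, o) ∈ S then (n : ℤ) else 0, fun i j => ?_⟩
    have k1 := key i j
    have k2 := key o o
    apply Int.cast_injective (α := ℂ)
    push_cast
    linear_combination k1 - k2

/-! ### Neighbours of a cell -/

/-- The matrix identity `A + 3 = R + C + L`, where `A` is the adjacency matrix of the graph and `R`,
`C`, `L` relate cells in the same row, in the same column and with the same letter: a cell other
than `v` shares at most one line with `v`. -/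
theorem rowCount_add_colCount_add_letterCount (Λ : LatinSquare n) (S : Finset (Cell n))
    (v : Cell n) :
    rowCount S v.1 + colCount S v.2 + Λ.letterCount S (Λ.letter v.1 v.2) =
      (Λ.graph.neighborFinset v ∩ S).card + 3 * if v ∈ S then 1 else 0 := by
  have h1 : (Λ.graph.neighborFinset v ∩ S).card = ∑ w ∈ S, if Λ.graph.Adj v w then 1 else 0 := by
    rw [← Finset.sum_filter, ← Finset.card_eq_sum_ones]
    congr 1
    ext w; simp [and_comm]
  have h2 : (if v ∈ S then 1 else 0) = ∑ w ∈ S, if w = v then 1 else 0 := by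
    simp
  rw [h1, h2, rowCount, colCount, letterCount, Finset.card_filter, Finset.card_filter,
    Finset.card_filter, Finset.mul_sum, ← Finset.sum_add_distrib, ← Finset.sum_add_distrib,
    ← Finset.sum_add_distrib]
  refine Finset.sum_congr rfl fun w _ => ?_
  obtain ⟨i, j⟩ := v
  obtain ⟨a, b⟩ := w
  have adj : Λ.graph.Adj (i, j) (a, b) ↔
      (i, j) ≠ (a, b) ∧ (i = a ∨ j = b ∨ Λ.letter i j = Λ.letter a b) := Iff.rfl
  have inj₁ : ∀ x, Λ.letter i x = Λ.letter i j → x = j := fun x h => (Λ.row_bijective i).1 h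
  have inj₂ : ∀ x, Λ.letter x j = Λ.letter i j → x = i := fun x h => (Λ.col_bijective j).1 h
  simp only [adj, Prod.mk.injEq, ne_eq]
  by_cases ha : a = i <;> by_cases hb : b = j
  · subst ha hb; simp
  · subst ha
    have : Λ.letter a b ≠ Λ.letter a j := fun h => hb (inj₁ b h)
    simp [hb, this, Ne.symm hb]
  · subst hb
    have : Λ.letter a b ≠ Λ.letter i b := fun h => ha (inj₂ a h)
    simp [ha, this, Ne.symm ha]
  · simp [ha, hb, Ne.symm ha, Ne.symm hb, eq_comm]

theorem graph_isRegularOfDegree (Λ : LatinSquare n) :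
    Λ.graph.IsRegularOfDegree (3 * n - 3) := by
  intro v
  have h := Λ.rowCount_add_colCount_add_letterCount Finset.univ v
  rw [rowCount_univ, colCount_univ, letterCount_univ] at h
  simp only [Finset.mem_univ, if_true, Finset.inter_univ, SimpleGraph.card_neighborFinset_eq_degree]
    at h
  omega

/-! ### Equitable partitions and the space `lineSpace` -/

/-- With `A` the adjacency matrix, `A + 3` maps every function into `lineSpace`. As the quotient
matrix `M` does not have the eigenvalue `-3`, `M + 3` is invertible, and so the indicator of each
part lies in the image of `A + 3`. -/
theorem cellInd_mem_lineSpace_of_isMuEquitable {Λ : LatinSquare n}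
    {Δ : Finpartition (Finset.univ : Finset (Cell n))}
    (h : IsMuEquitable Λ.graph Δ ((n : ℝ) - 3)) {D : Finset (Cell n)} (hD : D ∈ Δ.parts) :
    cellInd (D : Set (Cell n)) ∈ Λ.lineSpace := by
  obtain ⟨k, M, -, hM, hev⟩ := h
  -- For `n = 0` the two values `n - 3` and `-3` would coincide.
  have hn : n ≠ 0 := by
    rintro rfl
    obtain ⟨p, -⟩ := Δ.nonempty_of_mem_parts hD
    exact p.1.elim0
  set N := Matrix.toLin' (M.map (fun m => (m : ℂ))) with hN
  have inj : Function.Injective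
      (N + (3 : ℂ) • (LinearMap.id : (Δ.parts → ℂ) →ₗ[ℂ] Δ.parts → ℂ)) := by
    rw [← LinearMap.ker_eq_bot, LinearMap.ker_eq_bot']
    intro x hx
    by_contra hx0
    have h3 : Module.End.HasEigenvalue N (-3) := by
      refine Module.End.hasEigenvalue_of_hasEigenvector (x := x)
        (Module.End.hasEigenvector_iff.2 ⟨Module.End.mem_eigenspace_iff.2 ?_, hx0⟩)
      have : N x + (3 : ℂ) • x = 0 := by simpa using hx
      rw [neg_smul]
      exact eq_neg_of_add_eq_zero_left this
    have hk : (-3 : ℂ) ≠ (k : ℂ) := by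
      intro hk
      have : (-3 : ℤ) = k := by exact_mod_cast hk
      omega
    have := hev _ h3 hk
    push_cast at this
    exact hn (by exact_mod_cast (by linear_combination -this : (n : ℂ) = 0))
  obtain ⟨x, hx⟩ := LinearMap.injective_iff_surjective.1 inj (Pi.single ⟨D, hD⟩ 1)
  refine mem_lineSpace.2 ⟨fun i => ∑ E, x E * rowCount E.1 i, fun j => ∑ E, x E * colCount E.1 j,
    fun ℓ => ∑ E, x E * Λ.letterCount E.1 ℓ, fun i j => ?_⟩
  obtain ⟨E₀, hE₀, hv⟩ := Δ.exists_mem (Finset.mem_univ (i, j))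
  have mem_iff : ∀ E : Δ.parts, (i, j) ∈ E.1 ↔ E = ⟨E₀, hE₀⟩ := by
    intro E
    constructor
    · intro hE
      exact Subtype.ext (Δ.eq_of_mem_parts E.2 hE₀ hE hv)
    · rintro rfl
      exact hv
  have hx0 := congrFun hx ⟨E₀, hE₀⟩
  have hE : ∀ E : Δ.parts, x E * rowCount E.1 i + x E * colCount E.1 j +
      x E * Λ.letterCount E.1 (Λ.letter i j) =
        (M ⟨E₀, hE₀⟩ E : ℂ) * x E + if E = ⟨E₀, hE₀⟩ then 3 * x E else 0 := by
    intro E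
    have h1 := Λ.rowCount_add_colCount_add_letterCount E.1 (i, j)
    rw [hM ⟨E₀, hE₀⟩ E (i, j) hv] at h1
    have h2 : (rowCount E.1 i : ℂ) + colCount E.1 j + Λ.letterCount E.1 (Λ.letter i j) =
      M ⟨E₀, hE₀⟩ E + 3 * if (i, j) ∈ E.1 then 1 else 0 := by exact_mod_cast h1
    simp only [mem_iff E] at h2
    split_ifs at h2 ⊢
    · linear_combination x E * h2
    · linear_combination x E * h2
  rw [← Finset.sum_add_distrib, ← Finset.sum_add_distrib, Finset.sum_congr rfl fun E _ => hE E,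
    Finset.sum_add_distrib, cellInd_apply]
  have h4 : (if (i, j) ∈ D then (1 : ℂ) else 0) =
      (Pi.single ⟨D, hD⟩ 1 : Δ.parts → ℂ) ⟨E₀, hE₀⟩ := by
    rw [Pi.single_apply]
    simp only [mem_iff ⟨D, hD⟩, eq_comm]
  rw [h4, ← hx0]
  simp [hN, Matrix.mulVec, dotProduct]

/-- If the indicator of each part is in `lineSpace`, the quotient matrix is `(n - 3) I` plus a
matrix all of whose rows are equal; so an eigenvector for an eigenvalue other than `n - 3` is
constant. -/
theorem isMuEquitable_of_cellInd_mem_lineSpace {Λ : LatinSquare n}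
    {Δ : Finpartition (Finset.univ : Finset (Cell n))}
    (h : ∀ D ∈ Δ.parts, cellInd (D : Set (Cell n)) ∈ Λ.lineSpace) :
    IsMuEquitable Λ.graph Δ ((n : ℝ) - 3) := by
  choose m hm using fun D : Δ.parts => exists_count_relation (h D.1 D.2)
  choose v hv using fun D : Δ.parts => Δ.nonempty_of_mem_parts D.2
  have mem_iff : ∀ (D E : Δ.parts) (p : Cell n), p ∈ D.1 → (p ∈ E.1 ↔ D = E) := by
    intro D E p hp
    constructor
    · intro hE
      exact Subtype.ext (Δ.eq_of_mem_parts D.2 E.2 hp hE)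
    · rintro rfl
      exact hp
  have hcard : ∀ D E : Δ.parts, ∀ p ∈ D.1, ((Λ.graph.neighborFinset p ∩ E.1).card : ℤ) =
      m E + if D = E then (n : ℤ) - 3 else 0 := by
    intro D E p hp
    have h1 := Λ.rowCount_add_colCount_add_letterCount E.1 p
    have h2 := hm E p.1 p.2
    zify at h1
    rw [h1] at h2
    simp only [Prod.mk.eta, mem_iff D E p hp] at h2
    split_ifs at h2 ⊢ <;> push_cast at h2 <;> linarith
  let M : Matrix Δ.parts Δ.parts ℕ := fun D E => (Λ.graph.neighborFinset (v D) ∩ E.1).card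
  have hMc : ∀ D E : Δ.parts, (M D E : ℂ) = m E + if D = E then (n : ℂ) - 3 else 0 := by
    intro D E
    have := hcard D E (v D) (hv D)
    exact_mod_cast congrArg (Int.cast : ℤ → ℂ) this
  have hrow : ∀ D : Δ.parts, ∑ E, (M D E : ℂ) = ((3 * n - 3 : ℕ) : ℂ) := by
    intro D
    have h1 : ∑ E : Δ.parts, M D E = (Λ.graph.neighborFinset (v D)).card := by
      have := Finset.card_eq_sum_card_fiberwise (s := Λ.graph.neighborFinset (v D))
        (t := Δ.parts) (f := Δ.part) (fun p _ => Δ.part_mem.2 (Finset.mem_univ p))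
      rw [this, ← Finset.sum_coe_sort Δ.parts
        (fun E => ((Λ.graph.neighborFinset (v D)).filter fun p => Δ.part p = E).card)]
      refine Finset.sum_congr rfl fun E _ => congrArg Finset.card ?_
      ext p
      simp only [Finset.mem_inter, Finset.mem_filter, and_congr_right_iff]
      intro _
      constructor
      · exact fun hp => Δ.part_eq_of_mem E.2 hp
      · rintro hp
        rw [← hp]
        exact Δ.mem_part (Finset.mem_univ p)
    rw [SimpleGraph.card_neighborFinset_eq_degree, Λ.graph_isRegularOfDegree (v D)] at h1
    exact_mod_cast h1
  refine ⟨3 * n - 3, M, Λ.graph_isRegularOfDegree, fun D E p hp => ?_, fun θ hθ hk => ?_⟩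
  · have h1 := hcard D E p hp
    have h2 := hcard D E (v D) (hv D)
    exact_mod_cast h1.trans h2.symm
  · obtain ⟨x, hx⟩ := hθ.exists_hasEigenvector
    by_contra hne
    have hne' : θ - ((n : ℂ) - 3) ≠ 0 := by
      intro h0
      apply hne
      push_cast
      linear_combination h0
    have hx1 : ∀ D, ∑ E, (M D E : ℂ) * x E = θ * x D := by
      intro D
      have := congrFun hx.apply_eq_smul D
      simpa [Matrix.mulVec, dotProduct] using this
    have hx2 : ∀ D, (θ - ((n : ℂ) - 3)) * x D = ∑ E, (m E : ℂ) * x E := by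
      intro D
      have := hx1 D
      simp only [hMc, add_mul, Finset.sum_add_distrib, ite_mul, zero_mul, Finset.sum_ite_eq,
        Finset.mem_univ, if_true] at this
      linear_combination -this
    obtain ⟨D, hD⟩ := Function.ne_iff.1 hx.2
    have hconst : ∀ E, x E = x D := fun E =>
      mul_left_cancel₀ hne' ((hx2 E).trans (hx2 D).symm)
    have := hx1 D
    simp only [hconst, ← Finset.sum_mul, hrow] at this
    exact hk (mul_right_cancel₀ hD this).symm

/-! ### Rows, columns, letters and inflated corner sets are in `lineSpace` -/

theorem IsRow.cellInd_mem_lineSpace {S : Set (Cell n)} (h : IsRow S) (Λ : LatinSquare n) :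
    cellInd S ∈ Λ.lineSpace := by
  classical
  obtain ⟨i, rfl⟩ := h
  exact mem_lineSpace.2 ⟨fun a => if a = i then 1 else 0, 0, 0, fun a b => by
    simp [cellInd, Set.indicator_apply]⟩

theorem IsColumn.cellInd_mem_lineSpace {S : Set (Cell n)} (h : IsColumn S) (Λ : LatinSquare n) :
    cellInd S ∈ Λ.lineSpace := by
  classical
  obtain ⟨j, rfl⟩ := h
  exact mem_lineSpace.2 ⟨0, fun b => if b = j then 1 else 0, 0, fun a b => by
    simp [cellInd, Set.indicator_apply]⟩

theorem IsLetter.cellInd_mem_lineSpace {Λ : LatinSquare n} {S : Set (Cell n)}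
    (h : Λ.IsLetter S) : cellInd S ∈ Λ.lineSpace := by
  classical
  obtain ⟨ℓ, rfl⟩ := h
  exact mem_lineSpace.2 ⟨0, 0, fun b => if b = ℓ then 1 else 0, fun a b => by
    simp [cellInd, Set.indicator_apply]⟩

/-- In the cyclic square of order `t`, the integer `(i + j + 1) mod t - i - j` is `1` on the corner
set and `1 - t` off it. -/
theorem IsInflatedCornerSet.cellInd_mem_lineSpace {Λ : LatinSquare n} {S : Set (Cell n)}
    (h : Λ.IsInflatedCornerSet S) : cellInd S ∈ Λ.lineSpace := by
  classical
  obtain ⟨t, s, Λ₀, I, K, ⟨α, β, γ, hΛ₀, rfl⟩, rfl⟩ := h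
  refine mem_lineSpace.2
    ⟨fun i => (t - 1 - ((α.symm (I.fatRow i) : ℕ) : ℂ)) / t,
     fun j => (-((β.symm (I.fatColumn j) : ℕ) : ℂ)) / t,
     fun ℓ => ((((γ.symm (I.fatLetter ℓ) : ℕ) + 1) % t : ℕ) : ℂ) / t, fun i j => ?_⟩
  obtain ⟨a, ha⟩ := α.surjective (I.fatRow i)
  obtain ⟨b, hb⟩ := β.surjective (I.fatColumn j)
  have ht : (t : ℂ) ≠ 0 := by
    have := a.pos
    exact_mod_cast this.ne'
  have hℓ : I.fatLetter (Λ.letter i j) = γ ((cyclic t).letter a b) := by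
    rw [I.letter_mem, ← ha, ← hb, hΛ₀]
  have hval : (((cyclic t).letter a b : Fin t) : ℕ) = ((a : ℕ) + b) % t := Fin.val_add a b
  have hK : (i, j) ∈ I.inflate {q | ∃ i j : Fin t, (i : ℕ) + (j : ℕ) + 1 < t ∧ q = (α i, β j)} ↔
      (a : ℕ) + b + 1 < t := by
    simp [Inflation.inflate, ← ha, ← hb]
  dsimp only
  rw [hℓ, ← ha, ← hb]
  simp only [Equiv.symm_apply_apply, hval, cellInd, Set.indicator_apply, hK, Pi.one_apply,
    Nat.mod_add_mod]
  have hat := a.isLt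
  have hbt := b.isLt
  split_ifs with hlt
  · rw [Nat.mod_eq_of_lt hlt]
    field_simp
    push_cast
    ring
  · have : ((a : ℕ) + b + 1) % t = a + b + 1 - t := by
      rw [Nat.mod_eq_sub_mod (by omega), Nat.mod_eq_of_lt (by omega)]
    rw [this, Nat.cast_sub (by omega)]
    field_simp
    push_cast
    ring

theorem cellInd_sUnion_mem_lineSpace {Λ : LatinSquare n} {F : Set (Set (Cell n))}
    (hF : ∀ B ∈ F, cellInd B ∈ Λ.lineSpace) (hd : F.PairwiseDisjoint id) :
    cellInd (⋃₀ F) ∈ Λ.lineSpace := by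
  classical
  have hfin : F.Finite := Set.toFinite F
  have : cellInd (⋃₀ F) = ∑ B ∈ hfin.toFinset, cellInd B := by
    have h1 : (⋃₀ F) = ⋃ B ∈ hfin.toFinset, id B := by
      simp [Set.sUnion_eq_biUnion]
    rw [h1, cellInd, Finset.indicator_biUnion _ _ (by simpa using hd)]
    ext p
    simp [cellInd]
  rw [this]
  exact Submodule.sum_mem _ fun B hB => hF B (hfin.mem_toFinset.1 hB)

/-! ### Equidistribution of the line counts -/

/-- The number of indices at which `u` takes the value `x` modulo `n`. -/
def residueCount (u : Fin n → ℕ) (x : ZMod n) : ℕ :=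
  (Finset.univ.filter fun i => (u i : ZMod n) = x).card

theorem residueCount_comp (u : Fin n → ℕ) {e : Fin n → Fin n} (he : Function.Bijective e)
    (x : ZMod n) : residueCount (fun i => u (e i)) x = residueCount u x := by
  refine Finset.card_bij (fun i _ => e i) ?_ (fun _ _ _ _ h => he.1 h) ?_
  · intro i hi
    simpa using hi
  · intro j hj
    obtain ⟨i, rfl⟩ := he.2 j
    exact ⟨i, by simpa using hj, rfl⟩

/-- If `u` and `w` sum to a constant modulo `n`, then their value distributions are mirror
images. -/
theorem residueCount_eq_of_add_eq {u w : Fin n → ℕ} {y : ZMod n}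
    (h : ∀ i, (u i : ZMod n) + w i = y) (x : ZMod n) :
    residueCount u x = residueCount w (y - x) := by
  unfold residueCount
  congr 1
  ext i
  simp only [Finset.mem_filter, Finset.mem_univ, true_and]
  constructor
  · rintro rfl
    rw [← h i]; ring
  · intro hi
    have := h i
    rw [hi] at this
    linear_combination this

/-- If the values of `u` lie in one class modulo a divisor `s` of `n` and their distribution is
invariant under the shift by `s`, then each of the `n / s` possible values is taken `s` times. -/
theorem card_div_eq {s t : ℕ} (hs : 0 < s) (hst : s * t = n) {u : Fin n → ℕ} (hu : ∀ i, u i < n)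
    {u₀ : ℕ} (hu₀ : ∀ i, u i % s = u₀)
    (hper : ∀ x, residueCount u (x + (s : ZMod n)) = residueCount u x) {a : ℕ} (ha : a < t) :
    (Finset.univ.filter fun i => u i / s = a).card = s := by
  have hn : 0 < n := by rw [← hst]; exact Nat.mul_pos hs (by omega)
  have hu₀s : u₀ < s := by rw [← hu₀ ⟨0, hn⟩]; exact Nat.mod_lt _ hs
  have h1 : ∀ b < t, (Finset.univ.filter fun i => u i / s = b).card =
      residueCount u ((u₀ + s * b : ℕ) : ZMod n) := by
    intro b hb
    unfold residueCount
    congr 1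
    ext i
    simp only [Finset.mem_filter, Finset.mem_univ, true_and]
    have hlt : u₀ + s * b < n := by
      have : s * (b + 1) ≤ s * t := Nat.mul_le_mul_left s hb
      rw [← hst]
      linarith
    rw [ZMod.natCast_eq_natCast_iff', Nat.mod_eq_of_lt (hu i), Nat.mod_eq_of_lt hlt]
    have := Nat.mod_add_div (u i) s
    rw [hu₀ i] at this
    constructor
    · rintro rfl
      exact this.symm
    · intro h
      rw [h, Nat.add_mul_div_left _ _ hs, Nat.div_eq_of_lt hu₀s, Nat.zero_add]
  have h2 : ∀ b : ℕ, residueCount u ((u₀ + s * b : ℕ) : ZMod n) = residueCount u (u₀ : ZMod n) := by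
    intro b
    induction b with
    | zero => simp
    | succ b ih =>
      rw [← ih, ← hper ((u₀ + s * b : ℕ) : ZMod n)]
      congr 1
      push_cast
      ring
  have h3 : n = ∑ b ∈ Finset.range t, (Finset.univ.filter fun i => u i / s = b).card := by
    rw [← Finset.card_eq_sum_card_fiberwise (s := Finset.univ) (t := Finset.range t)
      (f := fun i => u i / s)]
    · simp
    · intro i _
      have : u i < t * s := by rw [mul_comm, hst]; exact hu i
      simpa using Nat.div_lt_of_lt_mul (by rw [mul_comm]; exact this)
  rw [Finset.sum_congr rfl fun b hb => (h1 b (Finset.mem_range.1 hb)).trans (h2 b),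
    Finset.sum_const, Finset.card_range, smul_eq_mul] at h3
  rw [h1 a ha, h2]
  have : t * residueCount u (u₀ : ZMod n) = t * s := by rw [← h3, ← hst, mul_comm]
  exact Nat.eq_of_mul_eq_mul_left (by omega) this

/-- The periods of `residueCount u`. -/
def periods (u : Fin n → ℕ) : AddSubgroup ℤ where
  carrier := {d | ∀ x, residueCount u (x + (d : ZMod n)) = residueCount u x}
  add_mem' := by
    intro a b ha hb x
    rw [← ha x, ← hb (x + a)]
    push_cast
    rw [add_assoc]
  zero_mem' := by intro x; simp
  neg_mem' := by
    intro a ha x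
    rw [← ha]
    simp

/-! ### Sets containing no line -/

/-- An inflation of the cyclic square read off from functions `u`, `v`, `w` that classify rows,
columns and letters. The reversal of rows and columns turns `u i + v j ≥ t` into the defining
inequality of the corner set, and the shift of the letters makes the quotient square the cyclic
one itself. -/
theorem isInflatedCornerSet_of_add_eq {Λ : LatinSquare n} {S : Finset (Cell n)} {s t : ℕ}
    (ht : 0 < t) {u v w : Fin n → ℕ} (hu : ∀ i, u i < t) (hv : ∀ j, v j < t) (hw : ∀ ℓ, w ℓ < t)
    (hus : ∀ a < t, (Finset.univ.filter fun i => u i = a).card = s)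
    (hvs : ∀ a < t, (Finset.univ.filter fun j => v j = a).card = s)
    (hws : ∀ a < t, (Finset.univ.filter fun ℓ => w ℓ = a).card = s)
    (hsum : ∀ i j, u i + v j + w (Λ.letter i j) + 1 = t + if (i, j) ∈ S then t else 0) :
    Λ.IsInflatedCornerSet (S : Set (Cell n)) := by
  have : NeZero t := ⟨ht.ne'⟩
  let I : Inflation Λ (cyclic t) s :=
    { fatRow := fun i => Fin.rev ⟨u i, hu i⟩
      fatColumn := fun j => Fin.rev ⟨v j, hv j⟩
      fatLetter := fun ℓ => ⟨w ℓ, hw ℓ⟩ - 1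
      card_fatRow := fun a => by
        rw [← hus a.rev a.rev.isLt]
        refine congrArg Finset.card (Finset.filter_congr fun i _ => ?_)
        rw [Fin.rev_eq_iff, Fin.ext_iff]
      card_fatColumn := fun a => by
        rw [← hvs a.rev a.rev.isLt]
        refine congrArg Finset.card (Finset.filter_congr fun i _ => ?_)
        rw [Fin.rev_eq_iff, Fin.ext_iff]
      card_fatLetter := fun a => by
        rw [← hws (a + 1 : Fin t) (a + 1).isLt]
        simp only [sub_eq_iff_eq_add, Fin.ext_iff]
      letter_mem := fun i j => by
        change _ = Fin.rev _ + Fin.rev _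
        rw [sub_eq_iff_eq_add, Fin.ext_iff, Fin.val_add, Fin.val_add, Fin.val_one',
          Nat.add_mod_mod, Nat.mod_add_mod, Fin.val_rev, Fin.val_rev]
        have h1 := hsum i j
        have h2 := hu i
        have h3 := hv j
        have h4 := hw (Λ.letter i j)
        simp only
        split_ifs at h1
        · rw [show t - (u i + 1) + (t - (v j + 1)) + 1 = w (Λ.letter i j) by omega,
            Nat.mod_eq_of_lt h4]
        · rw [show t - (u i + 1) + (t - (v j + 1)) + 1 = w (Λ.letter i j) + t by omega,
            Nat.add_mod_right, Nat.mod_eq_of_lt h4] }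
  refine ⟨t, s, cyclic t, I, {q | ∃ i j : Fin t, (i : ℕ) + (j : ℕ) + 1 < t ∧ q = (i, j)},
    ⟨1, 1, 1, fun _ _ => rfl, rfl⟩, ?_⟩
  ext ⟨i, j⟩
  have h1 := hsum i j
  have h2 := hu i
  have h3 := hv j
  have h4 := hw (Λ.letter i j)
  have h5 : (i, j) ∈ I.inflate {q | ∃ i j : Fin t, (i : ℕ) + (j : ℕ) + 1 < t ∧ q = (i, j)} ↔
      t - (u i + 1) + (t - (v j + 1)) + 1 < t := by
    simp [Inflation.inflate, I, Fin.val_rev]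
  rw [h5, Finset.mem_coe]
  split_ifs at h1 with hmem
  · simp only [hmem, true_iff]; omega
  · simp only [hmem, false_iff]; omega

/-- Since the line counts of `S` are less than `n`, they are determined by their residues modulo
`n`, and these satisfy `r i + c j + l (letter i j) = m`. Thus the distributions of `r`, `c` and `l`
over the residues are mirror images of one another, and differences of row counts or of column
counts are periods of them. If the periods are the multiples of `s`, each of `r`, `c`, `l` lies in
one class modulo `s` and is uniformly distributed on it, and the quotients by `s` give the
inflation. -/
theorem isInflatedCornerSet_of_count_lt {Λ : LatinSquare n} {S : Finset (Cell n)} {m : ℤ}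
    (hn : 0 < n)
    (hm : ∀ i j, (rowCount S i : ℤ) + colCount S j + Λ.letterCount S (Λ.letter i j) =
      m + if (i, j) ∈ S then (n : ℤ) else 0)
    (hr : ∀ i, rowCount S i < n) (hc : ∀ j, colCount S j < n) (hl : ∀ ℓ, Λ.letterCount S ℓ < n) :
    Λ.IsInflatedCornerSet (S : Set (Cell n)) := by
  set r := rowCount S
  set c := colCount S
  set l := Λ.letterCount S
  let o : Fin n := ⟨0, hn⟩
  have hmod : ∀ i j, (r i : ZMod n) + c j + l (Λ.letter i j) = (m : ZMod n) := by
    intro i j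
    have := congrArg (Int.cast : ℤ → ZMod n) (hm i j)
    push_cast at this
    rw [this]
    split_ifs <;> simp
  have hrow : ∀ i x, residueCount c x = residueCount l ((m : ZMod n) - r i - x) := by
    intro i x
    rw [← residueCount_comp l (Λ.row_bijective i)]
    exact residueCount_eq_of_add_eq (fun j => by rw [← hmod i j]; ring) x
  have hcol : ∀ j x, residueCount r x = residueCount l ((m : ZMod n) - c j - x) := by
    intro j x
    rw [← residueCount_comp l (Λ.col_bijective j)]
    exact residueCount_eq_of_add_eq (fun i => by rw [← hmod i j]; ring) x
  obtain ⟨s₀, hs₀⟩ := Int.subgroup_cyclic (periods l)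
  rw [← AddSubgroup.zmultiples_eq_closure] at hs₀
  have hdvd : ∀ d : ℤ, d ∈ periods l ↔ ((s₀.natAbs : ℕ) : ℤ) ∣ d := by
    intro d
    rw [hs₀, Int.mem_zmultiples_iff, Int.natAbs_dvd]
  obtain ⟨s, hs⟩ : ∃ s : ℕ, s = s₀.natAbs := ⟨_, rfl⟩
  rw [← hs] at hdvd
  have hsn : s ∣ n := by
    have : (n : ℤ) ∈ periods l := fun x => by simp
    exact_mod_cast (hdvd n).1 this
  obtain ⟨t, hst⟩ := hsn
  have hspos : 0 < s := Nat.pos_of_ne_zero fun h => by simp [h] at hst; omega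
  have htpos : 0 < t := Nat.pos_of_ne_zero fun h => by simp [h] at hst; omega
  have hsper : ∀ x, residueCount l (x + (s : ZMod n)) = residueCount l x := by
    have : (s : ℤ) ∈ periods l := (hdvd s).2 dvd_rfl
    intro x
    simpa using this x
  have hsper' : ∀ x, residueCount l (x - (s : ZMod n)) = residueCount l x := by
    intro x
    rw [← hsper, sub_add_cancel]
  have hcper : ∀ x, residueCount c (x + (s : ZMod n)) = residueCount c x := by
    intro x
    rw [hrow o, hrow o x, ← sub_sub, hsper']
  have hrper : ∀ x, residueCount r (x + (s : ZMod n)) = residueCount r x := by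
    intro x
    rw [hcol o, hcol o x, ← sub_sub, hsper']
  have hrs : ∀ i, r i % s = r o % s := by
    intro i
    have : (r o : ℤ) - r i ∈ periods l := by
      intro x
      have h1 := hrow i ((m : ZMod n) - r o - x)
      rw [hrow o] at h1
      convert h1.symm using 2
      · push_cast; ring
      · ring
    exact (Nat.modEq_iff_dvd.2 ((hdvd _).1 this))
  have hcs : ∀ j, c j % s = c o % s := by
    intro j
    have : (c o : ℤ) - c j ∈ periods l := by
      intro x
      have h1 := hcol j ((m : ZMod n) - c o - x)
      rw [hcol o] at h1
      convert h1.symm using 2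
      · push_cast; ring
      · ring
    exact (Nat.modEq_iff_dvd.2 ((hdvd _).1 this))
  obtain ⟨ℓ₀, hℓ₀⟩ : ∃ ℓ₀, ℓ₀ = Λ.letter o o := ⟨_, rfl⟩
  have hls : ∀ ℓ, l ℓ % s = l ℓ₀ % s := by
    intro ℓ
    obtain ⟨j, rfl⟩ := (Λ.row_bijective o).2 ℓ
    have h1 := hm o j
    have h2 := hm o o
    rw [← hℓ₀] at h2
    have h3 : (s : ℤ) ∣ (c o : ℤ) - c j := Nat.modEq_iff_dvd.1 (hcs j)
    have h4 : (s : ℤ) ∣ (if (o, o) ∈ S then (n : ℤ) else 0) -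
        if (o, j) ∈ S then (n : ℤ) else 0 := by
      have : (s : ℤ) ∣ n := ⟨t, by exact_mod_cast hst⟩
      apply dvd_sub <;> split_ifs <;> first | exact this | exact dvd_zero _
    refine Nat.modEq_iff_dvd.2 ?_
    have h5 : (l ℓ₀ : ℤ) - l (Λ.letter o j) = ((if (o, o) ∈ S then (n : ℤ) else 0) -
        if (o, j) ∈ S then (n : ℤ) else 0) - ((c o : ℤ) - c j) := by linarith
    rw [h5]
    exact dvd_sub h4 h3
  have hrcard := fun a : ℕ => card_div_eq (a := a) hspos hst.symm hr hrs hrper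
  have hccard := fun a : ℕ => card_div_eq (a := a) hspos hst.symm hc hcs hcper
  have hlcard := fun a : ℕ => card_div_eq (a := a) hspos hst.symm hl hls hsper
  have hdivlt : ∀ x < n, x / s < t := fun x hx => Nat.div_lt_of_lt_mul (hst ▸ hx)
  have hrdec : ∀ i, (r i : ℤ) = (r o % s : ℕ) + s * (r i / s : ℕ) := fun i => by
    rw [← hrs i]; exact_mod_cast (Nat.mod_add_div (r i) s).symm
  have hcdec : ∀ j, (c j : ℤ) = (c o % s : ℕ) + s * (c j / s : ℕ) := fun j => by
    rw [← hcs j]; exact_mod_cast (Nat.mod_add_div (c j) s).symm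
  have hldec : ∀ ℓ, (l ℓ : ℤ) = (l ℓ₀ % s : ℕ) + s * (l ℓ / s : ℕ) := fun ℓ => by
    rw [← hls ℓ]; exact_mod_cast (Nat.mod_add_div (l ℓ) s).symm
  obtain ⟨k, hk⟩ : ∃ k : ℤ, k = (r o % s : ℕ) + (c o % s : ℕ) + (l ℓ₀ % s : ℕ) := ⟨_, rfl⟩
  have hrel : ∀ i j, k + s * ((r i / s : ℕ) + (c j / s : ℕ) + (l (Λ.letter i j) / s : ℕ) : ℤ) =
      m + if (i, j) ∈ S then (n : ℤ) else 0 := by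
    intro i j
    rw [← hm i j, hrdec i, hcdec j, hldec (Λ.letter i j), hk]
    ring
  -- A row with the largest count has a cell outside `S`, which bounds `m` below; the cell of a
  -- smallest row and a smallest letter bounds `m` above.
  have hmk : m = k + s * ((t : ℤ) - 1) := by
    apply le_antisymm
    · obtain ⟨i, hi⟩ := Finset.card_pos.1 ((hrcard 0 htpos).symm ▸ hspos)
      obtain ⟨ℓ, hℓ⟩ := Finset.card_pos.1 ((hlcard 0 htpos).symm ▸ hspos)
      obtain ⟨j, rfl⟩ := (Λ.row_bijective i).2 ℓ
      have hi' : r i / s = 0 := (Finset.mem_filter.1 hi).2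
      have hℓ' : l (Λ.letter i j) / s = 0 := (Finset.mem_filter.1 hℓ).2
      have h1 := hrel i j
      rw [hi', hℓ'] at h1
      have h2 : ((c j / s : ℕ) : ℤ) ≤ t - 1 := by have := hdivlt _ (hc j); omega
      have h3 := mul_le_mul_of_nonneg_left h2 (Int.natCast_nonneg s)
      have h4 : (0 : ℤ) ≤ if (i, j) ∈ S then (n : ℤ) else 0 := by split_ifs <;> simp
      rw [Nat.cast_zero, zero_add, add_zero] at h1
      linarith
    · obtain ⟨i, hi⟩ := Finset.card_pos.1 ((hrcard (t - 1) (by omega)).symm ▸ hspos)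
      have hi' : r i / s = t - 1 := (Finset.mem_filter.1 hi).2
      obtain ⟨j, hj⟩ : ∃ j, (i, j) ∉ S := by
        by_contra! hall
        have h1 := rowCount_eq_sum S i
        simp only [cellInd_apply, hall, if_true] at h1
        have h2 : (rowCount S i : ℂ) = n := h1.trans (by simp)
        exact (hr i).ne (by exact_mod_cast h2)
      have h1 := hrel i j
      rw [hi', if_neg hj, Nat.cast_sub (by omega)] at h1
      have h2 : (0 : ℤ) ≤ s * ((c j / s : ℕ) + (l (Λ.letter i j) / s : ℕ)) := by positivity
      rw [Nat.cast_one, add_zero, add_assoc, mul_add] at h1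
      linarith
  have hsum : ∀ i j, r i / s + c j / s + l (Λ.letter i j) / s + 1 =
      t + if (i, j) ∈ S then t else 0 := by
    intro i j
    have h1 := hrel i j
    have h2 : (if (i, j) ∈ S then (n : ℤ) else 0) = s * if (i, j) ∈ S then (t : ℤ) else 0 := by
      split_ifs
      · exact_mod_cast hst
      · simp
    rw [hmk, h2, add_assoc k, ← mul_add] at h1
    have h3 := mul_left_cancel₀ (by exact_mod_cast hspos.ne' : (s : ℤ) ≠ 0) (add_left_cancel h1)
    generalize r i / s = a, c j / s = b, l (Λ.letter i j) / s = d at h3 ⊢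
    zify
    linarith
  exact isInflatedCornerSet_of_add_eq htpos (fun i => hdivlt _ (hr i)) (fun j => hdivlt _ (hc j))
    (fun ℓ => hdivlt _ (hl ℓ)) hrcard hccard hlcard hsum

/-! ### Decomposition into lines and a corner set -/

/-- `B` is one of the building blocks of the classification. -/
def IsBlock (Λ : LatinSquare n) (B : Set (Cell n)) : Prop :=
  IsRow B ∨ IsColumn B ∨ Λ.IsLetter B ∨ Λ.IsInflatedCornerSet B

theorem IsBlock.cellInd_mem_lineSpace {Λ : LatinSquare n} {B : Set (Cell n)}
    (h : Λ.IsBlock B) : cellInd B ∈ Λ.lineSpace := by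
  rcases h with h | h | h | h
  · exact h.cellInd_mem_lineSpace Λ
  · exact h.cellInd_mem_lineSpace Λ
  · exact h.cellInd_mem_lineSpace
  · exact h.cellInd_mem_lineSpace

/-- Either `S` contains a row, a column or a letter, or all line counts are less than `n` and `S`
itself is an inflated corner set. -/
theorem exists_isBlock_subset {Λ : LatinSquare n} {S : Finset (Cell n)} (hne : S.Nonempty)
    (hS : cellInd (S : Set (Cell n)) ∈ Λ.lineSpace) :
    ∃ B : Finset (Cell n), B.Nonempty ∧ B ⊆ S ∧ Λ.IsBlock (B : Set (Cell n)) := by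
  have hn : 0 < n := hne.choose.1.pos
  let o : Fin n := ⟨0, hn⟩
  by_cases h1 : ∃ i, ∀ p : Cell n, p.1 = i → p ∈ S
  · obtain ⟨i, hi⟩ := h1
    exact ⟨Finset.univ.filter fun p => p.1 = i, ⟨(i, o), by simp⟩,
      fun p hp => hi p (by simpa using hp), Or.inl ⟨i, by simp⟩⟩
  by_cases h2 : ∃ j, ∀ p : Cell n, p.2 = j → p ∈ S
  · obtain ⟨j, hj⟩ := h2
    exact ⟨Finset.univ.filter fun p => p.2 = j, ⟨(o, j), by simp⟩,
      fun p hp => hj p (by simpa using hp), Or.inr (Or.inl ⟨j, by simp⟩)⟩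
  by_cases h3 : ∃ ℓ, ∀ p : Cell n, Λ.letter p.1 p.2 = ℓ → p ∈ S
  · obtain ⟨ℓ, hℓ⟩ := h3
    obtain ⟨j, hj⟩ := (Λ.row_bijective o).2 ℓ
    exact ⟨Finset.univ.filter fun p => Λ.letter p.1 p.2 = ℓ, ⟨(o, j), by simpa using hj⟩,
      fun p hp => hℓ p (by simpa using hp), Or.inr (Or.inr (Or.inl ⟨ℓ, by simp⟩))⟩
  push Not at h1 h2 h3
  obtain ⟨m, hm⟩ := exists_count_relation hS
  have hlt : ∀ f : Cell n → Fin n, (∀ x, (Finset.univ.filter fun p => f p = x).card = n) →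
      (∀ x, ∃ p, f p = x ∧ p ∉ S) → ∀ x, (S.filter fun p => f p = x).card < n := by
    intro f hf hex x
    refine lt_of_lt_of_eq (Finset.card_lt_card ?_) (hf x)
    rw [Finset.ssubset_iff_of_subset (Finset.filter_subset_filter _ (Finset.subset_univ S))]
    obtain ⟨p, hp, hpS⟩ := hex x
    exact ⟨p, by simpa using hp, fun h => hpS (Finset.mem_filter.1 h).1⟩
  exact ⟨S, hne, subset_rfl, Or.inr (Or.inr (Or.inr (isInflatedCornerSet_of_count_lt hn hm
    (hlt Prod.fst rowCount_univ h1) (hlt Prod.snd colCount_univ h2)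
    (hlt (fun p => Λ.letter p.1 p.2) Λ.letterCount_univ h3))))⟩

/-- Blocks are split off one at a time; what remains has its indicator in `lineSpace` again. -/
theorem exists_blocks {Λ : LatinSquare n} (S : Finset (Cell n))
    (hS : cellInd (S : Set (Cell n)) ∈ Λ.lineSpace) :
    ∃ F : Set (Set (Cell n)), (∀ B ∈ F, Λ.IsBlock B) ∧ F.PairwiseDisjoint id ∧
      (S : Set (Cell n)) = ⋃₀ F := by
  classical
  induction S using Finset.strongInduction with
  | H S ih =>
    rcases S.eq_empty_or_nonempty with rfl | hne
    · exact ⟨∅, by simp, by simp, by simp⟩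
    · obtain ⟨B, hBne, hBS, hB⟩ := exists_isBlock_subset hne hS
      have hdiff : cellInd ((S \ B : Finset (Cell n)) : Set (Cell n)) ∈ Λ.lineSpace := by
        have : cellInd ((S \ B : Finset (Cell n)) : Set (Cell n)) =
            cellInd (S : Set (Cell n)) - cellInd (B : Set (Cell n)) := by
          rw [Finset.coe_sdiff]
          exact Set.indicator_sdiff (by exact_mod_cast hBS) 1
        rw [this]
        exact Submodule.sub_mem _ hS hB.cellInd_mem_lineSpace
      obtain ⟨F, hF, hd, hU⟩ := ih _ (Finset.sdiff_ssubset hBS hBne) hdiff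
      refine ⟨insert (B : Set (Cell n)) F, ?_, ?_, ?_⟩
      · rintro C (rfl | hC)
        · exact hB
        · exact hF C hC
      · refine hd.insert fun C hC _ => ?_
        have hCsub : C ⊆ ((S \ B : Finset (Cell n)) : Set (Cell n)) := by
          rw [hU]; exact Set.subset_sUnion_of_mem hC
        refine Set.disjoint_left.2 fun p hpB hpC => ?_
        exact (Finset.mem_sdiff.1 (Finset.mem_coe.1 (hCsub hpC))).2 hpB
      · rw [Set.sUnion_insert, ← hU, Finset.coe_sdiff, Set.union_sdiff_cancel]
        exact_mod_cast hBS

end LatinSquare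

theorem mainTheorem1 (n : ℕ) (Λ : LatinSquare n)
    (Δ : Finpartition (Finset.univ : Finset (Cell n))) :
    IsMuEquitable Λ.graph Δ ((n : ℝ) - 3) ↔
      ∀ D ∈ Δ.parts, ∃ F : Set (Set (Cell n)),
        (∀ B ∈ F, LatinSquare.IsRow B ∨ LatinSquare.IsColumn B ∨ Λ.IsLetter B ∨
          Λ.IsInflatedCornerSet B) ∧
        F.PairwiseDisjoint id ∧ (D : Set (Cell n)) = ⋃₀ F := by
  constructor
  · intro h D hD
    exact LatinSquare.exists_blocks D (LatinSquare.cellInd_mem_lineSpace_of_isMuEquitable h hD)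
  · intro h
    refine LatinSquare.isMuEquitable_of_cellInd_mem_lineSpace fun D hD => ?_
    obtain ⟨F, hF, hd, hU⟩ := h D hD
    rw [hU]
    exact LatinSquare.cellInd_sUnion_mem_lineSpace
      (fun B hB => LatinSquare.IsBlock.cellInd_mem_lineSpace (hF B hB)) hd
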